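/- **Setting.** Let $K$ be a commutative ring containing $\mathbb Q$ (for example a field $k$ of characteristic $0$, or a commutative algebra over such a field) and let $\mathcal A$ be a commutative $K$-algebra (the choice $K=\mathcal A$ is allowed). Modules, $\mathrm{Hom}$, $\otimes$ and $\Lambda^*$ without further specification are over $K$. *Fields and shell.* Let $\Phi_0$ be a free $\mathcal A$-module with finite basis $(e_a)$, and let $\partial_1,\dots,\partial_m$ be commuting derivations of $\mathcal A$, acting on $\Phi_0$ through components; for a symmetric multi-index $I$ let $\partial_I$ be the corresponding iterated derivation. Let $0\le r\le\infty$ and let $\Phi$ be the $\mathcal A$-module of jets $(\phi^a_I)_{a,\,|I|\le r}$, $\phi^a_I\in\mathcal A$ (for finite $r$ it is free on symbols $e_a^I$); for $\phi=\phi^ae_a\in\Phi_0$ put $\partial\phi=(\partial_I\phi^a)_{a,\,|I|\le r}\in\Phi$. Let $L$ be a polynomial over $\mathcal A$ in indeterminates $u^a_I$. The shell is $$\Sigma=\Big\{\phi\in\Phi_0 \;\Big|\; \sum_I(-1)^{|I|}\partial_I\Big(\tfrac{\partial L}{\partial u^a_I}(\partial_J\phi^b)\Big)=0\ \text{ for all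 } a\Big\}.$$ For a module $V$, a map $f\in \mathrm{Hom}(\Lambda^*\Phi,V)$ *vanishes on shell* if for every $\phi\in\Sigma$ one has $\sum_{p\ge0} f((\partial\phi)^p)=0$, where $(\partial\phi)^p=\partial\phi\wedge\cdots\wedge\partial\phi\in\Lambda^p\Phi$ and only finitely many terms of the sum are nonzero. Let $\mathcal N\subset\mathrm{Hom}(\Lambda^*\Phi,\Phi)$ be the submodule of the maps that vanish on shell. *Gauge algebra.* $\Lambda^*\Phi$ is the symmetric coalgebra of $\Phi$, with coproduct $\Delta$ given by unshuffles and product $m$. For $h\in\mathrm{Hom}(\Lambda^*\Phi,\Phi)$ let $\bar h=m\circ(h\otimes1)\circ\Delta$, and put $f\odot g=f\circ\bar g$, $[f,g]=f\odot g-g\odot f$. Let $\Xi$ be a module, $\delta:\Xi\to\mathrm{Hom}(\Lambda^*\Phi,\Phi)$ a linear map and $C:\Xi\times\Xi\to\mathrm{Hom}(\Lambda^*\Phi,\Xi)$ a skew-symmetric bilinear map. For $\pi,\pi_1,\pi_2\in\mathrm{Hom}(\Lambda^*\Phi,\Xi)$ put $$\hat\delta(\pi)=\mathrm{ev}\circ(\delta\circ\pi\otimes1)\circ\Delta,\qquad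 \hat C(\pi_1,\pi_2)=C\circ((\pi_1\otimes\pi_2)\otimes1)\circ(\Delta\otimes1)\circ\Delta,$$ $$[\pi_1,\pi_2]=\pi_1\circ\overline{\hat\delta(\pi_2)}-\pi_2\circ\overline{\hat\delta(\pi_1)}+\hat C(\pi_1,\pi_2).$$ Identify $\xi\in\Xi$ with the map in $\mathrm{Hom}(\Lambda^*\Phi,\Xi)$ that sends $1$ to $\xi$ and vanishes on $\Lambda^{n}\Phi$, $n\ge1$, and put $$\mathrm{Jacobi}(\xi_1,\xi_2,\xi_3)=[[\xi_1,\xi_2],\xi_3]-[[\xi_1,\xi_3],\xi_2]+[[\xi_2,\xi_3],\xi_1]\in\mathrm{Hom}(\Lambda^*\Phi,\Xi).$$ *The map $D$.* Let $\mathbb L$ be $\Xi$ in degree $0$ and $\Phi$ in degree $1$, so that in $\downarrow\mathbb L$ the elements of $\Xi$ are odd (degree $-1$) and those of $\Phi$ are even (degree $0$); thus $\Lambda^*(\downarrow\mathbb L)$ is the tensor product of the exterior coalgebra of $\Xi$ and the symmetric coalgebra $\Lambda^*\Phi$. Let $D:\Lambda^*(\downarrow\mathbb L)\to\,\downarrow\mathbb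 L$ be the linear map with $$D(\xi\wedge s)=\delta(\xi)(s),\qquad D(\xi_1\wedge\xi_2\wedge s)=C(\xi_1,\xi_2)(s)\qquad(s\in\Lambda^*\Phi)$$ (so $D(\xi)=\delta(\xi)(1)$), and $D=0$ on elements with no entry or with more than two entries from $\Xi$. Let $\overline D=m\circ(D\otimes1)\circ\Delta$ be the corresponding coderivation of $\Lambda^*(\downarrow\mathbb L)$, defined with the Koszul signs. **Statement.** Assume the generalized Berends–Burgers–van Dam hypothesis: $[\delta(\xi),\delta(\eta)]-\hat\delta(C(\xi,\eta))\in\mathcal N$ for all $\xi,\eta\in\Xi$. 1. There is a skew-symmetric bilinear map $\nu:\Xi\times\Xi\to\mathcal N$ with $[\delta(\xi),\delta(\eta)]=\hat\delta(C(\xi,\eta))+\nu(\xi,\eta)$ for all $\xi,\eta$, and for all $\xi_1,\xi_2\in\Xi$ and $s\in\Lambda^*\Phi$ $$D\circ\overline D(\xi_1\wedge\xi_2\wedge s)=-[\delta(\xi_1),\delta(\xi_2)](s)+\hat\delta(C(\xi_1,\xi_2))(s)=-\nu(\xi_1,\xi_2)(s).$$ 2. For all $\xi_1,\xi_2,\xi_3\in\Xi$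 and $s\in\Lambda^*\Phi$ $$D\circ\overline D(\xi_1\wedge\xi_2\wedge\xi_3\wedge s)=\mathrm{Jacobi}(\xi_1,\xi_2,\xi_3)(s).$$ 3. If $\mathrm{Jacobi}(\xi_1,\xi_2,\xi_3)$ vanishes on shell for all $\xi_1,\xi_2,\xi_3\in\Xi$, then $D$ is an on-shell sh-Lie structure on $\mathbb L$: $D$ has degree $+1$ and $D\circ\overline D$ vanishes on shell, that is, for every $\omega$ in the exterior algebra of $\Xi$ the map $\Lambda^*\Phi\to\Xi\oplus\Phi$, $s\mapsto D\circ\overline D(\omega\wedge s)$, vanishes on shell. -/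

import Mathlib

open scoped TensorProduct

noncomputable section

namespace OnShell

/-! ### Polynomial Lagrangian field theories, jets and the shell -/

/-- A polynomial Lagrangian field theory over the commutative ring `A`. The module `Φ₀` of fields is
free over `A` with the finite basis `basis = (e_a)`; `∂_0, …, ∂_{m-1}` are commuting derivations of
`A`, extended to `Φ₀` by acting on components; and `lagrangian` is a polynomial over `A` in the
indeterminates `u^a_I`, where `I : Fin m → ℕ` is a symmetric multi-index (`I μ` is the number of
times that `μ` occurs). -/
structure FieldTheory (A Φ₀ ι : Type*) [CommRing A] [AddCommGroup Φ₀] [Module A Φ₀]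
    (m : ℕ) where
  basis : Module.Basis ι A Φ₀
  deriv : Fin m → Derivation ℤ A A
  deriv_comm : ∀ μ ν f, deriv μ (deriv ν f) = deriv ν (deriv μ f)
  lagrangian : MvPolynomial (ι × (Fin m → ℕ)) A

/-- The indices `(a, I)` of the jet coordinates of order `|I| ≤ r`, where `r` may be `⊤`. -/
def JetIndex (ι : Type*) (m : ℕ) (r : ℕ∞) : Type _ :=
  {p : ι × (Fin m → ℕ) // ((∑ μ, p.2 μ : ℕ) : ℕ∞) ≤ r}

/-- The `A`-module `Φ` of jets `φ^a_I e_a^I` of order at most `r`. For finite `r` (and finitely many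
`e_a`) it is the free module on the symbols `e_a^I`; for `r = ⊤` the elements are infinite jets. -/
abbrev Jets (A ι : Type*) (m : ℕ) (r : ℕ∞) : Type _ := JetIndex ι m r → A

namespace FieldTheory

variable {A Φ₀ ι : Type*} [CommRing A] [AddCommGroup Φ₀] [Module A Φ₀] {m : ℕ}
  (T : FieldTheory A Φ₀ ι m)

/-- The iterated derivation `∂_I = ∂_0^{I 0} ∘ ⋯ ∘ ∂_{m-1}^{I (m-1)}`. -/
def iterDeriv (I : Fin m → ℕ) : Module.End ℤ A :=
  (List.ofFn fun μ => ((T.deriv μ : A →ₗ[ℤ] A) : Module.End ℤ A) ^ I μ).prod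

/-- The components `∂_I φ^a` of the field `φ = φ^a e_a` and of its derivatives. -/
def component (φ : Φ₀) (p : ι × (Fin m → ℕ)) : A :=
  T.iterDeriv p.2 (T.basis.repr φ p.1)

/-- The jet `∂φ = (∂_I φ^a) e_a^I` of the field `φ`. -/
def jet (r : ℕ∞) (φ : Φ₀) : Jets A ι m r := fun p => T.component φ p.1

/-- The Euler-Lagrange operator
`(E_a L)(φ) = ∑_I (-1)^{|I|} ∂_I ((∂L/∂u^a_I)(∂_J φ^b))`; only the finitely many `I` such that
`u^a_I` occurs in `L` contribute. -/
def eulerLagrange (a : ι) (φ : Φ₀) : A :=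
  ∑ᶠ I : Fin m → ℕ, (-1) ^ (∑ μ, I μ) *
    T.iterDeriv I (MvPolynomial.eval (T.component φ) (MvPolynomial.pderiv (a, I) T.lagrangian))

/-- The shell: the set of the solutions of the field equations. -/
def shell : Set Φ₀ := {φ | ∀ a, T.eulerLagrange a φ = 0}

variable (K : Type*) [CommRing K] [Algebra K A] (r : ℕ∞) (V : Type*) [AddCommGroup V] [Module K V]

/-- The subspace of the `f ∈ Hom(Λ*Φ, V)` that vanish on shell, that is,
`f(diag(∂φ)) = ∑_p f(∂φ ∧ ⋯ ∧ ∂φ) = 0` for all `φ` in the shell, where that sum is required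
to have only finitely many nonzero terms. -/
def onShellNull : Submodule K (SymmetricAlgebra K (Jets A ι m r) →ₗ[K] V) where
  carrier := {f | ∀ φ ∈ T.shell,
    (Function.support fun p : ℕ => f (SymmetricAlgebra.ι K _ (T.jet r φ) ^ p)).Finite ∧
      ∑ᶠ p : ℕ, f (SymmetricAlgebra.ι K _ (T.jet r φ) ^ p) = 0}
  zero_mem' := fun φ _ => by simp
  add_mem' := by
    intro f g hf hg φ hφ
    obtain ⟨hf1, hf2⟩ := hf φ hφ
    obtain ⟨hg1, hg2⟩ := hg φ hφ
    refine ⟨(hf1.union hg1).subset (Function.support_add _ _), ?_⟩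
    simp only [LinearMap.add_apply]
    rw [finsum_add_distrib hf1 hg1, hf2, hg2, add_zero]
  smul_mem' := by
    intro c f hf φ hφ
    obtain ⟨hf1, hf2⟩ := hf φ hφ
    refine ⟨hf1.subset (Function.support_const_smul_subset c _), ?_⟩
    simp only [LinearMap.smul_apply]
    rw [← smul_finsum' c hf1, hf2, smul_zero]

end FieldTheory

/-! ### The coalgebra `Λ*Φ` and the gauge algebra

`Λ*Φ` is the symmetric coalgebra of the module `Φ`, placed in even degree: `SymmetricAlgebra K Φ`
with the comultiplication of Mathlib, for which `Φ` is primitive, so that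
`Δ(φ₁ ∧ ⋯ ∧ φₙ)` is the sum over all unshuffles. -/

section Gauge

variable {K Φ Ξ : Type*} [CommRing K] [AddCommGroup Φ] [Module K Φ] [AddCommGroup Ξ] [Module K Ξ]

/-- The coderivation `h̄ = m ∘ (h ⊗ 1) ∘ Δ` of `Λ*Φ` with corestriction `h`. -/
def bar (h : SymmetricAlgebra K Φ →ₗ[K] Φ) : SymmetricAlgebra K Φ →ₗ[K] SymmetricAlgebra K Φ :=
  LinearMap.mul' K (SymmetricAlgebra K Φ) ∘ₗ
    TensorProduct.map (SymmetricAlgebra.ι K Φ ∘ₗ h) LinearMap.id ∘ₗ Coalgebra.comul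

/-- The Gerstenhaber bracket `[f, g] = f ∘ ḡ - g ∘ f̄` on `Hom(Λ*Φ, Φ)`. -/
def gerstenhaber (f g : SymmetricAlgebra K Φ →ₗ[K] Φ) : SymmetricAlgebra K Φ →ₗ[K] Φ :=
  f ∘ₗ bar g - g ∘ₗ bar f

/-- The extension `δ̂(π) = ev ∘ (δ ∘ π ⊗ 1) ∘ Δ` of `δ` to `Hom(Λ*Φ, Ξ)`. -/
def deltaHat (δ : Ξ →ₗ[K] SymmetricAlgebra K Φ →ₗ[K] Φ) (π : SymmetricAlgebra K Φ →ₗ[K] Ξ) :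
    SymmetricAlgebra K Φ →ₗ[K] Φ :=
  TensorProduct.lift (δ ∘ₗ π) ∘ₗ Coalgebra.comul

/-- The extension `Ĉ(π₁, π₂) = C ∘ ((π₁ ⊗ π₂) ⊗ 1) ∘ (Δ ⊗ 1) ∘ Δ` of `C` to `Hom(Λ*Φ, Ξ)`. -/
def CHat (C : Ξ →ₗ[K] Ξ →ₗ[K] SymmetricAlgebra K Φ →ₗ[K] Ξ)
    (π₁ π₂ : SymmetricAlgebra K Φ →ₗ[K] Ξ) : SymmetricAlgebra K Φ →ₗ[K] Ξ :=
  TensorProduct.lift (TensorProduct.lift (C.compl₁₂ π₁ π₂)) ∘ₗ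
    LinearMap.rTensor (SymmetricAlgebra K Φ) Coalgebra.comul ∘ₗ Coalgebra.comul

/-- The constant `ξ`, as the element of `Hom(Λ*Φ, Ξ)` with `ξ(1) = ξ` that is zero on
`φ₁ ∧ ⋯ ∧ φₙ` for `n ≥ 1`. -/
def const (ξ : Ξ) : SymmetricAlgebra K Φ →ₗ[K] Ξ :=
  (Coalgebra.counit : SymmetricAlgebra K Φ →ₗ[K] K).smulRight ξ

/-- The bracket `[π₁, π₂] = π₁ ∘ δ̂(π₂)⁻ - π₂ ∘ δ̂(π₁)⁻ + Ĉ(π₁, π₂)` on `Hom(Λ*Φ, Ξ)`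
(the superscript `⁻` stands for `bar`). -/
def bracket (δ : Ξ →ₗ[K] SymmetricAlgebra K Φ →ₗ[K] Φ)
    (C : Ξ →ₗ[K] Ξ →ₗ[K] SymmetricAlgebra K Φ →ₗ[K] Ξ)
    (π₁ π₂ : SymmetricAlgebra K Φ →ₗ[K] Ξ) : SymmetricAlgebra K Φ →ₗ[K] Ξ :=
  π₁ ∘ₗ bar (deltaHat δ π₂) - π₂ ∘ₗ bar (deltaHat δ π₁) + CHat C π₁ π₂

/-- The Jacobiator `[[ξ₁, ξ₂], ξ₃] - [[ξ₁, ξ₃], ξ₂] + [[ξ₂, ξ₃], ξ₁]` of three constants. -/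
def jacobiator (δ : Ξ →ₗ[K] SymmetricAlgebra K Φ →ₗ[K] Φ)
    (C : Ξ →ₗ[K] Ξ →ₗ[K] SymmetricAlgebra K Φ →ₗ[K] Ξ) (ξ₁ ξ₂ ξ₃ : Ξ) :
    SymmetricAlgebra K Φ →ₗ[K] Ξ :=
  bracket δ C (bracket δ C (const ξ₁) (const ξ₂)) (const ξ₃)
    - bracket δ C (bracket δ C (const ξ₁) (const ξ₃)) (const ξ₂)
    + bracket δ C (bracket δ C (const ξ₂) (const ξ₃)) (const ξ₁)

/-! ### The graded coalgebra `Λ*(↓𝕃)` and the maps `D` and `D̄`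

`𝕃` is `Ξ` in degree `0` and `Φ` in degree `1`, so that `↓𝕃` is `Ξ` in the odd degree `-1` and `Φ`
in degree `0`. The free graded commutative algebra on `↓𝕃` is `Λ(Ξ) ⊗ S(Φ)`, and
`ξ₁ ∧ ⋯ ∧ ξₘ ∧ φ₁ ∧ ⋯ ∧ φₙ` is the element `(ξ₁ ⋯ ξₘ) ⊗ (φ₁ ⋯ φₙ)`. -/

variable (K Φ Ξ) in
/-- `Λ*(↓𝕃)`; it carries the ordinary product of the tensor product of algebras, since all elements
of the second factor are even. -/
abbrev LambdaL : Type _ := ExteriorAlgebra K Ξ ⊗[K] SymmetricAlgebra K Φ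

variable (K Ξ) in
/-- The comultiplication of the exterior coalgebra as a homomorphism into the graded tensor product
(with the Koszul sign rule), with `Δ(ξ) = ξ ⊗ 1 + 1 ⊗ ξ`. Thus `Δ(ξ₁ ∧ ⋯ ∧ ξₘ)` is the sum over all
unshuffles with their signs. -/
def extComulAlgHom : ExteriorAlgebra K Ξ →ₐ[K]
    GradedTensorProduct K (fun i : ℕ => ⋀[K]^i Ξ) (fun i : ℕ => ⋀[K]^i Ξ) :=
  ExteriorAlgebra.lift K ⟨
    (GradedTensorProduct.includeLeft (fun i : ℕ => ⋀[K]^i Ξ)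
        (fun i : ℕ => ⋀[K]^i Ξ)).toLinearMap ∘ₗ ExteriorAlgebra.ι K
      + (GradedTensorProduct.includeRight (fun i : ℕ => ⋀[K]^i Ξ)
        (fun i : ℕ => ⋀[K]^i Ξ)).toLinearMap ∘ₗ ExteriorAlgebra.ι K, by
    intro ξ
    have h1 : ExteriorAlgebra.ι K ξ ∈ ⋀[K]^1 Ξ := by
      simpa only [pow_one] using LinearMap.mem_range_self (ExteriorAlgebra.ι K) ξ
    have h := GradedTensorProduct.tmul_coe_mul_coe_tmul (R := K) (fun i : ℕ => ⋀[K]^i Ξ)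
      (fun i : ℕ => ⋀[K]^i Ξ) (1 : ExteriorAlgebra K Ξ)
      (⟨ExteriorAlgebra.ι K ξ, h1⟩ : ⋀[K]^1 Ξ) (⟨ExteriorAlgebra.ι K ξ, h1⟩ : ⋀[K]^1 Ξ)
      (1 : ExteriorAlgebra K Ξ)
    simp only [one_mul, mul_one, uzpow_one, Units.neg_smul, one_smul] at h
    simp only [LinearMap.add_apply, LinearMap.comp_apply, AlgHom.toLinearMap_apply,
      GradedTensorProduct.includeLeft_apply, GradedTensorProduct.includeRight_apply,
      add_mul, mul_add, h, GradedTensorProduct.tmul_one_mul_one_tmul]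
    have h2 := GradedTensorProduct.tmul_one_mul_coe_tmul (R := K) (fun i : ℕ => ⋀[K]^i Ξ)
      (fun i : ℕ => ⋀[K]^i Ξ) (ExteriorAlgebra.ι K ξ)
      (⟨ExteriorAlgebra.ι K ξ, h1⟩ : ⋀[K]^1 Ξ) (1 : ExteriorAlgebra K Ξ)
    have h3 := GradedTensorProduct.tmul_coe_mul_one_tmul (R := K) (fun i : ℕ => ⋀[K]^i Ξ)
      (fun i : ℕ => ⋀[K]^i Ξ) (1 : ExteriorAlgebra K Ξ)
      (⟨ExteriorAlgebra.ι K ξ, h1⟩ : ⋀[K]^1 Ξ) (ExteriorAlgebra.ι K ξ)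
    rw [h2, h3]
    simp only [ExteriorAlgebra.ι_sq_zero, GradedTensorProduct.tmul, TensorProduct.zero_tmul,
      TensorProduct.tmul_zero, map_zero]
    abel⟩

variable (K Ξ) in
/-- The comultiplication of the exterior coalgebra, as a linear map. -/
def extComul : ExteriorAlgebra K Ξ →ₗ[K] ExteriorAlgebra K Ξ ⊗[K] ExteriorAlgebra K Ξ :=
  (GradedTensorProduct.of K (fun i : ℕ => ⋀[K]^i Ξ) (fun i : ℕ => ⋀[K]^i Ξ)).symm.toLinearMap ∘ₗ
    (extComulAlgHom K Ξ).toLinearMap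

variable (K Φ Ξ) in
/-- The comultiplication of `Λ*(↓𝕃)`; no sign arises as the elements of `S(Φ)` are even. -/
def lambdaComul : LambdaL K Φ Ξ →ₗ[K] LambdaL K Φ Ξ ⊗[K] LambdaL K Φ Ξ :=
  (TensorProduct.tensorTensorTensorComm K (ExteriorAlgebra K Ξ) (ExteriorAlgebra K Ξ)
      (SymmetricAlgebra K Φ) (SymmetricAlgebra K Φ)).toLinearMap ∘ₗ
    TensorProduct.map (extComul K Ξ) Coalgebra.comul

variable (K Φ Ξ) in
/-- The inclusion of `↓𝕃 = Ξ ⊕ Φ` in `Λ*(↓𝕃)`. -/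
def incl : Ξ × Φ →ₗ[K] LambdaL K Φ Ξ :=
  LinearMap.coprod
    ((TensorProduct.mk K (ExteriorAlgebra K Ξ) (SymmetricAlgebra K Φ)).flip 1 ∘ₗ
      ExteriorAlgebra.ι K)
    (TensorProduct.mk K (ExteriorAlgebra K Ξ) (SymmetricAlgebra K Φ) 1 ∘ₗ SymmetricAlgebra.ι K Φ)

/-- The coderivation `D̄ = m ∘ (D ⊗ 1) ∘ Δ` of `Λ*(↓𝕃)` with corestriction `D`. -/
def lambdaBar (D : LambdaL K Φ Ξ →ₗ[K] Ξ × Φ) : LambdaL K Φ Ξ →ₗ[K] LambdaL K Φ Ξ :=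
  LinearMap.mul' K (LambdaL K Φ Ξ) ∘ₗ
    TensorProduct.map (incl K Φ Ξ ∘ₗ D) LinearMap.id ∘ₗ lambdaComul K Φ Ξ

/-- Over a ring that contains `ℚ`, skew-symmetric bilinear maps are alternating. -/
theorem self_eq_zero_of_skew [Algebra ℚ K] {V : Type*} [AddCommGroup V] [Module K V]
    {C : Ξ →ₗ[K] Ξ →ₗ[K] V} (hC : ∀ ξ η, C ξ η = -C η ξ) (ξ : Ξ) : C ξ ξ = 0 := by
  have h2 : (2 : K) • C ξ ξ = 0 := by
    rw [two_smul]
    exact add_eq_zero_iff_eq_neg.mpr (hC ξ ξ)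
  have h3 : algebraMap ℚ K 2⁻¹ * 2 = 1 := by
    rw [← map_ofNat (algebraMap ℚ K) 2, ← map_mul]
    norm_num
  rw [← one_smul K (C ξ ξ), ← h3, mul_smul, h2, smul_zero]

/-- A skew-symmetric bilinear map, as an alternating map. -/
def skewToAlternating [Algebra ℚ K] {V : Type*} [AddCommGroup V] [Module K V]
    (C : Ξ →ₗ[K] Ξ →ₗ[K] V) (hC : ∀ ξ η, C ξ η = -C η ξ) : Ξ [⋀^Fin 2]→ₗ[K] V where
  toFun v := C (v 0) (v 1)
  map_update_add' := by
    intro _ v i x y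
    fin_cases i <;> simp [Function.update]
  map_update_smul' := by
    intro _ v i c x
    fin_cases i <;> simp [Function.update]
  map_eq_zero_of_eq' := by
    intro v i j hv hij
    have h01 : v 0 = v 1 := by
      fin_cases i <;> fin_cases j <;> simp_all
    rw [h01]
    exact self_eq_zero_of_skew hC (v 1)

/-- The map `D : Λ*(↓𝕃) → ↓𝕃 = Ξ ⊕ Φ`, given on `ξ₁ ∧ ⋯ ∧ ξₘ ∧ s` with `s ∈ Λ*Φ` by
`D(ξ ∧ s) = δ(ξ)(s) ∈ Φ` (in particular `D(ξ) = δ(ξ)(1) = ∂ξ`),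
`D(ξ₁ ∧ ξ₂ ∧ s) = C(ξ₁, ξ₂)(s) ∈ Ξ`, and `D = 0` for `m = 0` and for `m ≥ 3`. -/
def D [Algebra ℚ K] (δ : Ξ →ₗ[K] SymmetricAlgebra K Φ →ₗ[K] Φ)
    (C : Ξ →ₗ[K] Ξ →ₗ[K] SymmetricAlgebra K Φ →ₗ[K] Ξ) (hC : ∀ ξ η, C ξ η = -C η ξ) :
    LambdaL K Φ Ξ →ₗ[K] Ξ × Φ :=
  TensorProduct.lift (ExteriorAlgebra.liftAlternating fun
    | 1 => ((LinearMap.inr K Ξ Φ).compRight K ∘ₗ δ).compAlternatingMap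
        (AlternatingMap.ofSubsingleton K Ξ Ξ (0 : Fin 1) LinearMap.id)
    | 2 => ((LinearMap.inl K Ξ Φ).compRight K).compAlternatingMap (skewToAlternating C hC)
    | _ => 0)

end Gauge

/-! ### Vanishing on shell -/

section OnShellStructures

variable {K A Φ₀ ι Ξ : Type*} [CommRing K] [CommRing A] [Algebra K A] [AddCommGroup Φ₀]
  [Module A Φ₀] {m : ℕ} [AddCommGroup Ξ] [Module K Ξ]

/-- The generalized Berends-Burgers-van Dam hypothesis for `δ` and `C`: the commutator
`[δ(ξ), δ(η)]` equals `δ̂(C(ξ, η))` up to a term that vanishes on shell. -/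
def GeneralizedBBvD (T : FieldTheory A Φ₀ ι m) (r : ℕ∞)
    (δ : Ξ →ₗ[K] SymmetricAlgebra K (Jets A ι m r) →ₗ[K] Jets A ι m r)
    (C : Ξ →ₗ[K] Ξ →ₗ[K] SymmetricAlgebra K (Jets A ι m r) →ₗ[K] Ξ) : Prop :=
  (∀ ξ η, C ξ η = -C η ξ) ∧
    ∀ ξ η, gerstenhaber (δ ξ) (δ η) - deltaHat δ (C ξ η) ∈ T.onShellNull K r (Jets A ι m r)

/-- A linear map `D : Λ*(↓𝕃) → ↓𝕃` vanishes on shell if for every `ω ∈ Λ(Ξ)`, the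
map `s ↦ D(ω ∧ s)` on `Λ*Φ` does. -/
def VanishesOnShell (T : FieldTheory A Φ₀ ι m) (r : ℕ∞)
    (F : LambdaL K (Jets A ι m r) Ξ →ₗ[K] Ξ × Jets A ι m r) : Prop :=
  ∀ ω : ExteriorAlgebra K Ξ,
    F ∘ₗ TensorProduct.mk K _ _ ω ∈ T.onShellNull K r (Ξ × Jets A ι m r)

/-- `D : Λ*(↓𝕃) → ↓𝕃` is an on-shell sh-Lie structure on `𝕃`: it has degree `+1`, and `D ∘ D̄`
vanishes on shell. Here `ω ∧ s` has degree `-i` if `ω ∈ Λ^i(Ξ)`, so that `D(ω ∧ s)` has to be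
in degree `1 - i` of `↓𝕃`, which is `Φ` for `i = 1`, `Ξ` for `i = 2` and zero otherwise. -/
structure IsOnShellShLie (T : FieldTheory A Φ₀ ι m) (r : ℕ∞)
    (D : LambdaL K (Jets A ι m r) Ξ →ₗ[K] Ξ × Jets A ι m r) : Prop where
  snd_eq_zero : ∀ i : ℕ, i ≠ 1 → ∀ ω ∈ ⋀[K]^i Ξ, ∀ s, (D (ω ⊗ₜ s)).2 = 0
  fst_eq_zero : ∀ i : ℕ, i ≠ 2 → ∀ ω ∈ ⋀[K]^i Ξ, ∀ s, (D (ω ⊗ₜ s)).1 = 0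
  vanishes : VanishesOnShell T r (D ∘ₗ lambdaBar D)

end OnShellStructures

end OnShell

end

/-! Writing `D̄` as a sum over unshuffles of the `Ξ`-entries, only blocks of one or two entries can
be fed to `D`. A block of one is replaced by an element of `Φ`, and a block of two by an element of
`Ξ`, so in both cases `D̄` lowers the number of `Ξ`-entries by exactly one. As `D` sees only one or
two entries, `D ∘ D̄` can be nonzero only on two or three.

On two entries the split 2|0 gives `δ̂(C(ξ₁, ξ₂))`, and the two splits 1|1, with opposite Koszul
signs, give minus the commutator. On three entries the splits 2|1 give the terms quadratic in `C`,
and the splits 1|2 give `C` composed with `bar (δ ξ)`. These are the six terms of the Jacobiator of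
constants, because a bracket with a constant on the right collapses to two terms
(`bracket_const_right`). Both formulas are identities that need no closure hypothesis; the
hypotheses enter only when these two values are required to vanish on shell.

The unshuffle formulas come from the multiplicativity of the exterior coproduct (`extComul_ι_mul`,
`primitiveMul_tmul`). The three `barTerm_tmul_of_eq_*` lemmas then evaluate each summand. -/

namespace OnShell

section ShLie

variable {K Φ Ξ : Type*} [CommRing K] [AddCommGroup Φ] [Module K Φ] [AddCommGroup Ξ] [Module K Ξ]

/-! ### Vanishing on shell is stable under composition -/

/-- A linear map commutes with finite sums and can only shrink the support. This moves null maps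
from `Ξ` and from `Φ` into the summands of `Ξ × Φ`. -/
theorem comp_mem_onShellNull {A Φ₀ ι : Type*} [CommRing A] [AddCommGroup Φ₀] [Module A Φ₀] {m : ℕ}
    [Algebra K A] (T : FieldTheory A Φ₀ ι m) (r : ℕ∞) {V W : Type*} [AddCommGroup V] [Module K V]
    [AddCommGroup W] [Module K W] (g : V →ₗ[K] W)
    {f : SymmetricAlgebra K (Jets A ι m r) →ₗ[K] V} (hf : f ∈ T.onShellNull K r V) :
    g ∘ₗ f ∈ T.onShellNull K r W := by
  intro φ hφ
  obtain ⟨h1, h2⟩ := hf φ hφ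
  refine ⟨h1.subset (Function.support_comp_subset (map_zero g) _), ?_⟩
  have := (g : V →+ W).map_finsum h1
  simp only [LinearMap.comp_apply]
  rw [h2, map_zero] at this
  exact this.symm

/-! ### The exterior comultiplication -/

theorem ι_mem_exteriorPower_one (ξ : Ξ) : ExteriorAlgebra.ι K ξ ∈ ⋀[K]^1 Ξ := by
  simpa only [pow_one] using LinearMap.mem_range_self (ExteriorAlgebra.ι K) ξ

theorem ι_mul_mem_exteriorPower_succ (ξ : Ξ) {n : ℕ} {ω : ExteriorAlgebra K Ξ}
    (hω : ω ∈ ⋀[K]^n Ξ) : ExteriorAlgebra.ι K ξ * ω ∈ ⋀[K]^(n + 1) Ξ := by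
  rw [add_comm]
  exact SetLike.mul_mem_graded (A := fun i : ℕ => ⋀[K]^i Ξ) (ι_mem_exteriorPower_one ξ) hω

theorem one_mem_exteriorPower_zero : (1 : ExteriorAlgebra K Ξ) ∈ ⋀[K]^0 Ξ :=
  SetLike.one_mem_graded (fun i : ℕ => ⋀[K]^i Ξ)

variable (K) in
/-- Left multiplication by `ξ ⊗ 1 + 1 ⊗ ξ` in the graded tensor product. -/
noncomputable def primitiveMul (ξ : Ξ) : ExteriorAlgebra K Ξ ⊗[K] ExteriorAlgebra K Ξ →ₗ[K]
    ExteriorAlgebra K Ξ ⊗[K] ExteriorAlgebra K Ξ :=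
  (GradedTensorProduct.of K (fun i : ℕ => ⋀[K]^i Ξ) (fun i : ℕ => ⋀[K]^i Ξ)).symm.toLinearMap ∘ₗ
    LinearMap.mulLeft K (extComulAlgHom K Ξ (ExteriorAlgebra.ι K ξ)) ∘ₗ
    (GradedTensorProduct.of K (fun i : ℕ => ⋀[K]^i Ξ) (fun i : ℕ => ⋀[K]^i Ξ)).toLinearMap

theorem extComul_one : extComul K Ξ 1 = 1 ⊗ₜ 1 := by
  simp only [extComul, LinearMap.comp_apply, AlgHom.toLinearMap_apply, map_one]
  rfl

/-- Multiplicativity of the coproduct gives a recursion on the number of factors, from which all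
unshuffle formulas below follow. -/
theorem extComul_ι_mul (ξ : Ξ) (ω : ExteriorAlgebra K Ξ) :
    extComul K Ξ (ExteriorAlgebra.ι K ξ * ω) = primitiveMul K ξ (extComul K Ξ ω) := by
  simp [extComul, primitiveMul]

/-- The only sign comes from `1 ⊗ ξ`, whose odd entry has to pass `a`; the degree of `b` plays no
role. -/
theorem primitiveMul_tmul (ξ : Ξ) {n : ℕ} {a : ExteriorAlgebra K Ξ} (ha : a ∈ ⋀[K]^n Ξ)
    (b : ExteriorAlgebra K Ξ) :
    primitiveMul K ξ (a ⊗ₜ b) = (ExteriorAlgebra.ι K ξ * a) ⊗ₜ b +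
      (-1 : ℤˣ) ^ n • (a ⊗ₜ (ExteriorAlgebra.ι K ξ * b)) := by
  have h2 := GradedTensorProduct.tmul_one_mul_coe_tmul (R := K) (fun i : ℕ => ⋀[K]^i Ξ)
    (fun i : ℕ => ⋀[K]^i Ξ) (ExteriorAlgebra.ι K ξ) ⟨a, ha⟩ b
  have h3 := GradedTensorProduct.tmul_coe_mul_coe_tmul (R := K) (fun i : ℕ => ⋀[K]^i Ξ)
    (fun i : ℕ => ⋀[K]^i Ξ) 1 ⟨ExteriorAlgebra.ι K ξ, ι_mem_exteriorPower_one ξ⟩ ⟨a, ha⟩ b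
  simp only [one_mul] at h3
  simp only [primitiveMul, LinearMap.comp_apply, LinearMap.mulLeft_apply, extComulAlgHom,
    ExteriorAlgebra.lift_ι_apply, LinearMap.add_apply, AlgHom.toLinearMap_apply,
    GradedTensorProduct.includeLeft_apply, GradedTensorProduct.includeRight_apply, add_mul,
    map_add]
  congr 1

theorem extComul_ι (ξ : Ξ) : extComul K Ξ (ExteriorAlgebra.ι K ξ) =
    ExteriorAlgebra.ι K ξ ⊗ₜ 1 + 1 ⊗ₜ ExteriorAlgebra.ι K ξ := by
  rw [← mul_one (ExteriorAlgebra.ι K ξ), extComul_ι_mul, extComul_one,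
    primitiveMul_tmul ξ one_mem_exteriorPower_zero]
  simp

theorem extComul_ι_mul_ι (ξ₁ ξ₂ : Ξ) :
    extComul K Ξ (ExteriorAlgebra.ι K ξ₁ * ExteriorAlgebra.ι K ξ₂) =
      (ExteriorAlgebra.ι K ξ₁ * ExteriorAlgebra.ι K ξ₂) ⊗ₜ 1 +
      ExteriorAlgebra.ι K ξ₁ ⊗ₜ ExteriorAlgebra.ι K ξ₂ -
      ExteriorAlgebra.ι K ξ₂ ⊗ₜ ExteriorAlgebra.ι K ξ₁ +
      1 ⊗ₜ (ExteriorAlgebra.ι K ξ₁ * ExteriorAlgebra.ι K ξ₂) := by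
  rw [extComul_ι_mul, extComul_ι, map_add, primitiveMul_tmul ξ₁ (ι_mem_exteriorPower_one ξ₂),
    primitiveMul_tmul ξ₁ one_mem_exteriorPower_zero]
  simp
  abel

theorem extComul_ι_mul_ι_mul_ι (ξ₁ ξ₂ ξ₃ : Ξ) :
    extComul K Ξ (ExteriorAlgebra.ι K ξ₁ * (ExteriorAlgebra.ι K ξ₂ * ExteriorAlgebra.ι K ξ₃)) =
      (ExteriorAlgebra.ι K ξ₁ * (ExteriorAlgebra.ι K ξ₂ * ExteriorAlgebra.ι K ξ₃)) ⊗ₜ 1 +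
      (ExteriorAlgebra.ι K ξ₁ * ExteriorAlgebra.ι K ξ₂) ⊗ₜ ExteriorAlgebra.ι K ξ₃ -
      (ExteriorAlgebra.ι K ξ₁ * ExteriorAlgebra.ι K ξ₃) ⊗ₜ ExteriorAlgebra.ι K ξ₂ +
      (ExteriorAlgebra.ι K ξ₂ * ExteriorAlgebra.ι K ξ₃) ⊗ₜ ExteriorAlgebra.ι K ξ₁ +
      ExteriorAlgebra.ι K ξ₁ ⊗ₜ (ExteriorAlgebra.ι K ξ₂ * ExteriorAlgebra.ι K ξ₃) -
      ExteriorAlgebra.ι K ξ₂ ⊗ₜ (ExteriorAlgebra.ι K ξ₁ * ExteriorAlgebra.ι K ξ₃) +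
      ExteriorAlgebra.ι K ξ₃ ⊗ₜ (ExteriorAlgebra.ι K ξ₁ * ExteriorAlgebra.ι K ξ₂) +
      1 ⊗ₜ (ExteriorAlgebra.ι K ξ₁ * (ExteriorAlgebra.ι K ξ₂ * ExteriorAlgebra.ι K ξ₃)) := by
  rw [extComul_ι_mul, extComul_ι_mul_ι, map_add, map_sub, map_add,
    primitiveMul_tmul ξ₁ (ι_mul_mem_exteriorPower_succ ξ₂ (ι_mem_exteriorPower_one ξ₃)),
    primitiveMul_tmul ξ₁ (ι_mem_exteriorPower_one ξ₂),
    primitiveMul_tmul ξ₁ (ι_mem_exteriorPower_one ξ₃),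
    primitiveMul_tmul ξ₁ one_mem_exteriorPower_zero]
  simp
  abel

/-- The exterior comultiplication preserves the total degree. -/
theorem extComul_ιMulti_mem_span {n : ℕ} (v : Fin n → Ξ) :
    extComul K Ξ (ExteriorAlgebra.ιMulti K n v) ∈ Submodule.span K
      {t | ∃ i j, i + j = n ∧ ∃ a ∈ ⋀[K]^i Ξ, ∃ b ∈ ⋀[K]^j Ξ, t = a ⊗ₜ[K] b} := by
  induction n with
  | zero =>
    rw [ExteriorAlgebra.ιMulti_zero_apply, extComul_one]
    exact Submodule.subset_span
      ⟨0, 0, rfl, 1, one_mem_exteriorPower_zero, 1, one_mem_exteriorPower_zero, rfl⟩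
  | succ n ih =>
    rw [ExteriorAlgebra.ιMulti_succ_apply, extComul_ι_mul]
    refine Submodule.span_induction (p := fun t _ => primitiveMul K (v 0) t ∈ _) ?_ ?_ ?_ ?_
      (ih (Matrix.vecTail v))
    · rintro _ ⟨i, j, hij, a, ha, b, hb, rfl⟩
      rw [primitiveMul_tmul _ ha]
      refine add_mem (Submodule.subset_span ⟨i + 1, j, by omega, _,
        ι_mul_mem_exteriorPower_succ _ ha, b, hb, rfl⟩) ?_
      have h : a ⊗ₜ[K] (ExteriorAlgebra.ι K (v 0) * b) ∈ Submodule.span K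
          {t | ∃ i j, i + j = n + 1 ∧ ∃ a ∈ ⋀[K]^i Ξ, ∃ b ∈ ⋀[K]^j Ξ, t = a ⊗ₜ[K] b} :=
        Submodule.subset_span ⟨i, j + 1, by omega, a, ha, _,
          ι_mul_mem_exteriorPower_succ _ hb, rfl⟩
      -- The Koszul sign is harmless, since a span is closed under negation.
      rcases Int.units_eq_one_or ((-1 : ℤˣ) ^ i) with h1 | h1 <;> rw [h1]
      · rwa [one_smul]
      · rw [Units.neg_smul, one_smul]
        exact neg_mem h
    · rw [map_zero]
      exact zero_mem _
    · intro x y _ _ hx hy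
      rw [map_add]
      exact add_mem hx hy
    · intro c x _ hx
      rw [map_smul]
      exact Submodule.smul_mem _ c hx

/-! ### The gauge algebra -/

open Coalgebra in
-- Every term of `bar h s` has a factor in `Φ`, which the counit kills. Hence a constant composed
-- with any coderivation is zero.
theorem counit_bar (h : SymmetricAlgebra K Φ →ₗ[K] Φ) (s : SymmetricAlgebra K Φ) :
    counit (R := K) (bar h s) = 0 := by
  simp only [bar, LinearMap.comp_apply]
  induction comul (R := K) s with
  | zero => simp
  | add x y hx hy => simp [hx, hy]
  | tmul x y => simp [Bialgebra.counit_mul]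

theorem deltaHat_const (δ : Ξ →ₗ[K] SymmetricAlgebra K Φ →ₗ[K] Φ) (ξ : Ξ) :
    deltaHat δ (const ξ) = δ ξ := by
  ext s
  have h : ∀ t : SymmetricAlgebra K Φ ⊗[K] SymmetricAlgebra K Φ,
      TensorProduct.lift (δ ∘ₗ const ξ) t =
        δ ξ (TensorProduct.lid K _ (Coalgebra.counit.rTensor _ t)) := by
    intro t
    induction t with
    | zero => simp
    | add x y hx hy => simp [hx, hy]
    | tmul x y => simp [const]
  simp only [deltaHat, LinearMap.comp_apply]
  rw [h, Coalgebra.rTensor_counit_comul]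
  simp

/-- A constant factors through the counit, so the counit law removes the inner coproduct. -/
theorem CHat_const_right (C : Ξ →ₗ[K] Ξ →ₗ[K] SymmetricAlgebra K Φ →ₗ[K] Ξ)
    (π : SymmetricAlgebra K Φ →ₗ[K] Ξ) (η : Ξ) :
    CHat C π (const η) = TensorProduct.lift (C.flip η ∘ₗ π) ∘ₗ Coalgebra.comul := by
  have h0 : ∀ t : SymmetricAlgebra K Φ ⊗[K] SymmetricAlgebra K Φ,
      TensorProduct.lift (C.compl₁₂ π (const η)) t =
        C (π (TensorProduct.rid K _ (Coalgebra.counit.lTensor _ t))) η := by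
    intro t
    induction t with
    | zero => simp
    | add x y hx hy => simp [hx, hy]
    | tmul x y => simp [const]
  ext s
  simp only [CHat, LinearMap.comp_apply]
  induction Coalgebra.comul (R := K) s with
  | zero => simp
  | add x y hx hy => simp only [map_add, hx, hy]
  | tmul x y => simp [h0]

theorem bar_add (f g : SymmetricAlgebra K Φ →ₗ[K] Φ) : bar (f + g) = bar f + bar g := by
  simp only [bar, LinearMap.comp_add, TensorProduct.map_add_left, LinearMap.add_comp]

theorem bar_smul (c : K) (f : SymmetricAlgebra K Φ →ₗ[K] Φ) : bar (c • f) = c • bar f := by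
  simp only [bar, LinearMap.comp_smul, TensorProduct.map_smul_left, LinearMap.smul_comp]

theorem deltaHat_add (δ : Ξ →ₗ[K] SymmetricAlgebra K Φ →ₗ[K] Φ)
    (π₁ π₂ : SymmetricAlgebra K Φ →ₗ[K] Ξ) :
    deltaHat δ (π₁ + π₂) = deltaHat δ π₁ + deltaHat δ π₂ := by
  have h : TensorProduct.lift (δ ∘ₗ (π₁ + π₂)) =
      TensorProduct.lift (δ ∘ₗ π₁) + TensorProduct.lift (δ ∘ₗ π₂) :=
    TensorProduct.ext' fun x y => by simp
  simp only [deltaHat, h, LinearMap.add_comp]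

theorem deltaHat_smul (δ : Ξ →ₗ[K] SymmetricAlgebra K Φ →ₗ[K] Φ) (c : K)
    (π : SymmetricAlgebra K Φ →ₗ[K] Ξ) : deltaHat δ (c • π) = c • deltaHat δ π := by
  have h : TensorProduct.lift (δ ∘ₗ (c • π)) = c • TensorProduct.lift (δ ∘ₗ π) :=
    TensorProduct.ext' fun x y => by simp
  simp only [deltaHat, h, LinearMap.smul_comp]

theorem bracket_const_const (δ : Ξ →ₗ[K] SymmetricAlgebra K Φ →ₗ[K] Φ)
    (C : Ξ →ₗ[K] Ξ →ₗ[K] SymmetricAlgebra K Φ →ₗ[K] Ξ) (ξ η : Ξ) : bracket δ C (const ξ) (const η) = C ξ η := by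
  ext s
  have h0 : ∀ t : SymmetricAlgebra K Φ ⊗[K] SymmetricAlgebra K Φ,
      TensorProduct.lift (C.flip η ∘ₗ const ξ) t =
        C ξ η (TensorProduct.lid K _ (Coalgebra.counit.rTensor _ t)) := by
    intro t
    induction t with
    | zero => simp
    | add x y hx hy => simp [hx, hy]
    | tmul x y => simp [const]
  simp only [bracket, CHat_const_right, LinearMap.add_apply, LinearMap.sub_apply,
    LinearMap.comp_apply, h0, Coalgebra.rTensor_counit_comul]
  simp [const, counit_bar]

/-- With `π = C ξ₁ ξ₂`, the two surviving terms are the contributions of one split 1|2 and one split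
2|1 to `D ∘ D̄`. -/
theorem bracket_const_right (δ : Ξ →ₗ[K] SymmetricAlgebra K Φ →ₗ[K] Φ)
    (C : Ξ →ₗ[K] Ξ →ₗ[K] SymmetricAlgebra K Φ →ₗ[K] Ξ) (π : SymmetricAlgebra K Φ →ₗ[K] Ξ) (η : Ξ) :
    bracket δ C π (const η) = π ∘ₗ bar (δ η) +
      TensorProduct.lift (C.flip η ∘ₗ π) ∘ₗ Coalgebra.comul := by
  have h : const η ∘ₗ bar (deltaHat δ π) = 0 := by
    ext s
    simp [const, counit_bar]
  rw [bracket, h, deltaHat_const, CHat_const_right, sub_zero]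

/-! ### The coderivation `D̄` on homogeneous elements -/

/-- The contribution of a term `a ⊗ b` of the exterior comultiplication to `D̄`. -/
noncomputable def barTerm (F : LambdaL K Φ Ξ →ₗ[K] Ξ × Φ) (s : SymmetricAlgebra K Φ) :
    ExteriorAlgebra K Ξ ⊗[K] ExteriorAlgebra K Ξ →ₗ[K] LambdaL K Φ Ξ :=
  LinearMap.mul' K (LambdaL K Φ Ξ) ∘ₗ
    TensorProduct.map (incl K Φ Ξ ∘ₗ F) LinearMap.id ∘ₗ
    (TensorProduct.tensorTensorTensorComm K (ExteriorAlgebra K Ξ) (ExteriorAlgebra K Ξ)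
      (SymmetricAlgebra K Φ) (SymmetricAlgebra K Φ)).toLinearMap ∘ₗ
    (TensorProduct.mk K _ _).flip (Coalgebra.comul s)

theorem lambdaBar_tmul (F : LambdaL K Φ Ξ →ₗ[K] Ξ × Φ) (ω : ExteriorAlgebra K Ξ)
    (s : SymmetricAlgebra K Φ) :
    lambdaBar F (ω ⊗ₜ s) = barTerm F s (extComul K Ξ ω) := rfl

theorem barTerm_tmul_of_eq_zero {F : LambdaL K Φ Ξ →ₗ[K] Ξ × Φ} {a : ExteriorAlgebra K Ξ}
    (ha : ∀ s, F (a ⊗ₜ s) = 0) (b : ExteriorAlgebra K Ξ) (s : SymmetricAlgebra K Φ) :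
    barTerm F s (a ⊗ₜ b) = 0 := by
  simp only [barTerm, LinearMap.comp_apply, LinearMap.flip_apply, TensorProduct.mk_apply]
  induction Coalgebra.comul (R := K) s with
  | zero => simp
  | add x y hx hy => simp only [TensorProduct.tmul_add, map_add, hx, hy, add_zero]
  | tmul x y => simp [ha]

/-- An output in `Φ` is even and multiplies only the symmetric factor, so `b` is left untouched and
the sum over the coproduct of `s` closes up to `bar f s`. -/
theorem barTerm_tmul_of_eq_inr {F : LambdaL K Φ Ξ →ₗ[K] Ξ × Φ} {a : ExteriorAlgebra K Ξ}
    {f : SymmetricAlgebra K Φ →ₗ[K] Φ} (ha : ∀ s, F (a ⊗ₜ s) = (0, f s))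
    (b : ExteriorAlgebra K Ξ) (s : SymmetricAlgebra K Φ) :
    barTerm F s (a ⊗ₜ b) = b ⊗ₜ bar f s := by
  simp only [barTerm, bar, LinearMap.comp_apply, LinearMap.flip_apply, TensorProduct.mk_apply]
  induction Coalgebra.comul (R := K) s with
  | zero => simp
  | add x y hx hy => simp only [TensorProduct.tmul_add, map_add, hx, hy]
  | tmul x y => simp [ha, incl]

/-- An output in `Ξ` joins the exterior factor on the left of `b`, so the sum over the coproduct of
`s` remains open until `D` is applied again. -/
theorem barTerm_tmul_of_eq_inl {F : LambdaL K Φ Ξ →ₗ[K] Ξ × Φ} {a : ExteriorAlgebra K Ξ}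
    {f : SymmetricAlgebra K Φ →ₗ[K] Ξ} (ha : ∀ s, F (a ⊗ₜ s) = (f s, 0))
    (b : ExteriorAlgebra K Ξ) (s : SymmetricAlgebra K Φ) :
    barTerm F s (a ⊗ₜ b) =
      TensorProduct.map (LinearMap.mulRight K b ∘ₗ ExteriorAlgebra.ι K ∘ₗ f) LinearMap.id
        (Coalgebra.comul (R := K) s) := by
  simp only [barTerm, LinearMap.comp_apply, LinearMap.flip_apply, TensorProduct.mk_apply]
  induction Coalgebra.comul (R := K) s with
  | zero => simp
  | add x y hx hy => simp only [TensorProduct.tmul_add, map_add, hx, hy]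
  | tmul x y => simp [ha, incl]

/-! ### Values of `D` -/

section D

variable [Algebra ℚ K] (δ : Ξ →ₗ[K] SymmetricAlgebra K Φ →ₗ[K] Φ)
  (C : Ξ →ₗ[K] Ξ →ₗ[K] SymmetricAlgebra K Φ →ₗ[K] Ξ) (hC : ∀ ξ η, C ξ η = -C η ξ)

theorem D_ι (ξ : Ξ) (s : SymmetricAlgebra K Φ) :
    D δ C hC (ExteriorAlgebra.ι K ξ ⊗ₜ s) = (0, δ ξ s) := by
  simp [D]

theorem D_ι_mul_ι (ξ η : Ξ) (s : SymmetricAlgebra K Φ) :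
    D δ C hC ((ExteriorAlgebra.ι K ξ * ExteriorAlgebra.ι K η) ⊗ₜ s) = (C ξ η s, 0) := by
  have h : ExteriorAlgebra.ι K ξ * ExteriorAlgebra.ι K η = ExteriorAlgebra.ιMulti K 2 ![ξ, η] := by
    simp [ExteriorAlgebra.ιMulti_apply]
  rw [h]
  exact LinearMap.congr_fun (ExteriorAlgebra.liftAlternating_apply_ιMulti _ ![ξ, η]) s

theorem D_eq_zero {n : ℕ} (h1 : n ≠ 1) (h2 : n ≠ 2) {ω : ExteriorAlgebra K Ξ} (hω : ω ∈ ⋀[K]^n Ξ)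
    (s : SymmetricAlgebra K Φ) : D δ C hC (ω ⊗ₜ s) = 0 := by
  rw [← ExteriorAlgebra.ιMulti_span_fixedDegree] at hω
  induction hω using Submodule.span_induction with
  | zero => simp
  | add x y _ _ hx hy => rw [TensorProduct.add_tmul, map_add, hx, hy, add_zero]
  | smul c x _ hx => rw [← TensorProduct.smul_tmul', map_smul, hx, smul_zero]
  | mem x hx =>
    obtain ⟨v, rfl⟩ := hx
    -- Degrees 1 and 2 are excluded, and all others fall under the zero branch in the definition of
    -- `D`.
    match n, h1, h2 with
    | 0, _, _ => simp [D]
    | n + 3, _, _ =>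
      exact LinearMap.congr_fun (ExteriorAlgebra.liftAlternating_apply_ιMulti _ v) s

theorem exists_D_eq_inr {ω : ExteriorAlgebra K Ξ} (hω : ω ∈ ⋀[K]^1 Ξ) :
    ∃ f : SymmetricAlgebra K Φ →ₗ[K] Φ, ∀ s, D δ C hC (ω ⊗ₜ s) = (0, f s) := by
  obtain ⟨ξ, rfl⟩ : ω ∈ LinearMap.range (ExteriorAlgebra.ι K (M := Ξ)) := by
    simpa only [pow_one] using hω
  exact ⟨δ ξ, D_ι δ C hC ξ⟩

/-- Elements of degree two are only sums of products `ξ ∧ η`, so `f` is assembled along the span.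
Its exact form is irrelevant; only the vanishing of the `Φ`-component matters. -/
theorem exists_D_eq_inl {ω : ExteriorAlgebra K Ξ} (hω : ω ∈ ⋀[K]^2 Ξ) :
    ∃ f : SymmetricAlgebra K Φ →ₗ[K] Ξ, ∀ s, D δ C hC (ω ⊗ₜ s) = (f s, 0) := by
  rw [← ExteriorAlgebra.ιMulti_span_fixedDegree] at hω
  induction hω using Submodule.span_induction with
  | zero => exact ⟨0, fun s => by rw [TensorProduct.zero_tmul, map_zero]; rfl⟩
  | add x y _ _ hx hy =>
    obtain ⟨f, hf⟩ := hx
    obtain ⟨g, hg⟩ := hy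
    exact ⟨f + g, fun s => by simp [TensorProduct.add_tmul, hf, hg]⟩
  | smul c x _ hx =>
    obtain ⟨f, hf⟩ := hx
    exact ⟨c • f, fun s => by rw [← TensorProduct.smul_tmul', map_smul, hf]; simp⟩
  | mem x hx =>
    obtain ⟨v, rfl⟩ := hx
    refine ⟨C (v 0) (v 1), fun s => ?_⟩
    exact LinearMap.congr_fun (ExteriorAlgebra.liftAlternating_apply_ιMulti _ v) s

/-! ### The composite `D ∘ D̄` -/

theorem D_map_mulRight_one (f : SymmetricAlgebra K Φ →ₗ[K] Ξ)
    (t : SymmetricAlgebra K Φ ⊗[K] SymmetricAlgebra K Φ) :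
    D δ C hC (TensorProduct.map (LinearMap.mulRight K (1 : ExteriorAlgebra K Ξ) ∘ₗ
      ExteriorAlgebra.ι K ∘ₗ f) LinearMap.id t) = (0, TensorProduct.lift (δ ∘ₗ f) t) := by
  induction t with
  | zero => simp only [map_zero, Prod.mk_zero_zero]
  | add x y hx hy => simp only [map_add, hx, hy, Prod.mk_add_mk, add_zero]
  | tmul x y => simp [D_ι]

theorem D_map_mulRight_ι (f : SymmetricAlgebra K Φ →ₗ[K] Ξ) (η : Ξ)
    (t : SymmetricAlgebra K Φ ⊗[K] SymmetricAlgebra K Φ) :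
    D δ C hC (TensorProduct.map (LinearMap.mulRight K (ExteriorAlgebra.ι K η) ∘ₗ
      ExteriorAlgebra.ι K ∘ₗ f) LinearMap.id t) = (TensorProduct.lift (C.flip η ∘ₗ f) t, 0) := by
  induction t with
  | zero => simp only [map_zero, Prod.mk_zero_zero]
  | add x y hx hy => simp only [map_add, hx, hy, Prod.mk_add_mk, add_zero]
  | tmul x y => simp [D_ι_mul_ι]

theorem D_map_mulRight_eq_zero (f : SymmetricAlgebra K Φ →ₗ[K] Ξ) {n : ℕ} (hn : 2 ≤ n)
    {b : ExteriorAlgebra K Ξ} (hb : b ∈ ⋀[K]^n Ξ)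
    (t : SymmetricAlgebra K Φ ⊗[K] SymmetricAlgebra K Φ) :
    D δ C hC (TensorProduct.map (LinearMap.mulRight K b ∘ₗ ExteriorAlgebra.ι K ∘ₗ f)
      LinearMap.id t) = 0 := by
  induction t with
  | zero => simp
  | add x y hx hy => simp only [map_add, hx, hy, add_zero]
  | tmul x y =>
    exact D_eq_zero δ C hC (by omega) (by omega) (ι_mul_mem_exteriorPower_succ (f x) hb) y

theorem D_lambdaBar_one (s : SymmetricAlgebra K Φ) :
    D δ C hC (lambdaBar (D δ C hC) (1 ⊗ₜ s)) = 0 := by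
  rw [lambdaBar_tmul, extComul_one, barTerm_tmul_of_eq_zero
    (D_eq_zero δ C hC zero_ne_one (by decide) one_mem_exteriorPower_zero), map_zero]

theorem D_lambdaBar_ι (ξ : Ξ) (s : SymmetricAlgebra K Φ) :
    D δ C hC (lambdaBar (D δ C hC) (ExteriorAlgebra.ι K ξ ⊗ₜ s)) = 0 := by
  rw [lambdaBar_tmul, extComul_ι, map_add, barTerm_tmul_of_eq_inr (D_ι δ C hC ξ),
    barTerm_tmul_of_eq_zero (D_eq_zero δ C hC zero_ne_one (by decide) one_mem_exteriorPower_zero),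
    add_zero, D_eq_zero δ C hC zero_ne_one (by decide) one_mem_exteriorPower_zero]

theorem D_lambdaBar_ι_mul_ι (ξ₁ ξ₂ : Ξ) (s : SymmetricAlgebra K Φ) :
    D δ C hC (lambdaBar (D δ C hC) ((ExteriorAlgebra.ι K ξ₁ * ExteriorAlgebra.ι K ξ₂) ⊗ₜ s)) =
      (0, -gerstenhaber (δ ξ₁) (δ ξ₂) s + deltaHat δ (C ξ₁ ξ₂) s) := by
  rw [lambdaBar_tmul, extComul_ι_mul_ι, map_add (barTerm _ s), map_sub (barTerm _ s),
    map_add (barTerm _ s), barTerm_tmul_of_eq_inl (D_ι_mul_ι δ C hC ξ₁ ξ₂),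
    barTerm_tmul_of_eq_inr (D_ι δ C hC ξ₁), barTerm_tmul_of_eq_inr (D_ι δ C hC ξ₂),
    barTerm_tmul_of_eq_zero (D_eq_zero δ C hC zero_ne_one (by decide) one_mem_exteriorPower_zero),
    add_zero, map_sub, map_add, D_map_mulRight_one, D_ι, D_ι]
  simp only [gerstenhaber, deltaHat, LinearMap.sub_apply, LinearMap.comp_apply, Prod.mk_add_mk,
    Prod.mk_sub_mk, add_zero, sub_zero, Prod.mk.injEq, true_and]
  abel

/-- Of the eight unshuffles, 3|0 and 0|3 die because `D` vanishes on the first block. The other six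
match the Jacobiator term by term, signs included. -/
theorem D_lambdaBar_ι_mul_ι_mul_ι (ξ₁ ξ₂ ξ₃ : Ξ) (s : SymmetricAlgebra K Φ) :
    D δ C hC (lambdaBar (D δ C hC)
      ((ExteriorAlgebra.ι K ξ₁ * ExteriorAlgebra.ι K ξ₂ * ExteriorAlgebra.ι K ξ₃) ⊗ₜ s)) =
      (jacobiator δ C ξ₁ ξ₂ ξ₃ s, 0) := by
  have h2 : ∀ ξ η : Ξ, ExteriorAlgebra.ι K ξ * ExteriorAlgebra.ι K η ∈ ⋀[K]^2 Ξ := fun ξ η =>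
    ι_mul_mem_exteriorPower_succ ξ (ι_mem_exteriorPower_one η)
  rw [mul_assoc, lambdaBar_tmul, extComul_ι_mul_ι_mul_ι]
  simp only [map_add, map_sub, barTerm_tmul_of_eq_inl (D_ι_mul_ι δ C hC _ _),
    barTerm_tmul_of_eq_inr (D_ι δ C hC _),
    barTerm_tmul_of_eq_zero (D_eq_zero δ C hC zero_ne_one (by decide) one_mem_exteriorPower_zero),
    barTerm_tmul_of_eq_zero (D_eq_zero δ C hC (by decide) (by decide)
      (ι_mul_mem_exteriorPower_succ ξ₁ (h2 ξ₂ ξ₃))), D_map_mulRight_ι, D_ι_mul_ι,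
    jacobiator, bracket_const_const,
    bracket_const_right δ C (C _ _), LinearMap.add_apply,
    LinearMap.sub_apply, LinearMap.comp_apply, Prod.mk_add_mk, Prod.mk_sub_mk, add_zero, zero_add,
    sub_zero, Prod.mk.injEq, and_true]
  abel

/-- After a first block of size 1 or 2, exactly `n - 1 ≥ 3` entries from `Ξ` remain, and `D` kills
them. -/
theorem D_lambdaBar_ιMulti_eq_zero {n : ℕ} (hn : 4 ≤ n) (v : Fin n → Ξ)
    (s : SymmetricAlgebra K Φ) :
    D δ C hC (lambdaBar (D δ C hC) (ExteriorAlgebra.ιMulti K n v ⊗ₜ s)) = 0 := by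
  rw [lambdaBar_tmul]
  refine Submodule.span_induction (p := fun t _ => D δ C hC (barTerm (D δ C hC) s t) = 0)
    ?_ ?_ ?_ ?_ (extComul_ιMulti_mem_span v)
  · rintro _ ⟨i, j, hij, a, ha, b, hb, rfl⟩
    by_cases h1 : i = 1
    · subst h1
      obtain ⟨f, hf⟩ := exists_D_eq_inr δ C hC ha
      rw [barTerm_tmul_of_eq_inr hf, D_eq_zero δ C hC (by omega) (by omega) hb]
    by_cases h2 : i = 2
    · subst h2
      obtain ⟨f, hf⟩ := exists_D_eq_inl δ C hC ha
      rw [barTerm_tmul_of_eq_inl hf, D_map_mulRight_eq_zero δ C hC f (by omega) hb]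
    · rw [barTerm_tmul_of_eq_zero (D_eq_zero δ C hC h1 h2 ha), map_zero]
  · simp
  · intro x y _ _ hx hy
    simp only [map_add, hx, hy, add_zero]
  · intro c x _ hx
    simp only [map_smul, hx, smul_zero]

end D

/-! ### ### On-shell vanishing and the closure defect -/

/-- `D ∘ D̄` vanishes on shell as soon as it does so on two and on three entries from `Ξ`. -/
theorem vanishesOnShell_of_jacobiator {A Φ₀ ι : Type*} [CommRing A] [Algebra ℚ K] [Algebra K A]
    [AddCommGroup Φ₀] [Module A Φ₀] {m : ℕ} (T : FieldTheory A Φ₀ ι m) (r : ℕ∞)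
    (δ : Ξ →ₗ[K] SymmetricAlgebra K (Jets A ι m r) →ₗ[K] Jets A ι m r)
    (C : Ξ →ₗ[K] Ξ →ₗ[K] SymmetricAlgebra K (Jets A ι m r) →ₗ[K] Ξ)
    (h : GeneralizedBBvD T r δ C)
    (hJ : ∀ ξ₁ ξ₂ ξ₃, jacobiator δ C ξ₁ ξ₂ ξ₃ ∈ T.onShellNull K r Ξ) :
    VanishesOnShell T r (D δ C h.1 ∘ₗ lambdaBar (D δ C h.1)) := by
  intro ω
  have hω : ω ∈ (⊤ : Submodule K (ExteriorAlgebra K Ξ)) := trivial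
  rw [← ExteriorAlgebra.ιMulti_span] at hω
  induction hω using Submodule.span_induction with
  | zero =>
    rw [map_zero, LinearMap.comp_zero]
    exact zero_mem _
  | add x y _ _ hx hy =>
    rw [map_add, LinearMap.comp_add]
    exact add_mem hx hy
  | smul c x _ hx =>
    rw [map_smul, LinearMap.comp_smul]
    exact Submodule.smul_mem _ c hx
  | mem x hx =>
    obtain ⟨⟨n, v⟩, rfl⟩ := hx
    have h0 : ∀ f : SymmetricAlgebra K (Jets A ι m r) →ₗ[K] Ξ × Jets A ι m r, (∀ s, f s = 0) →
        f ∈ T.onShellNull K r (Ξ × Jets A ι m r) := fun f hf => by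
      rw [LinearMap.ext (g := 0) hf]
      exact zero_mem _
    match n, v with
    | 0, v =>
      refine h0 _ fun s => ?_
      simpa using D_lambdaBar_one δ C h.1 s
    | 1, v =>
      refine h0 _ fun s => ?_
      simpa [ExteriorAlgebra.ιMulti_apply] using D_lambdaBar_ι δ C h.1 (v 0) s
    | 2, v =>
      -- On two entries `D ∘ D̄` is minus the closure defect, placed in the summand `Φ`.
      convert comp_mem_onShellNull T r (LinearMap.inr K Ξ (Jets A ι m r))
        (neg_mem (h.2 (v 0) (v 1))) using 1
      refine LinearMap.ext fun s => ?_
      have := D_lambdaBar_ι_mul_ι δ C h.1 (v 0) (v 1) s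
      simp only [LinearMap.comp_apply, TensorProduct.mk_apply, ExteriorAlgebra.ιMulti_apply,
        List.ofFn_succ, List.ofFn_zero, List.prod_cons, List.prod_nil, mul_one]
      refine this.trans ?_
      simp [neg_add_eq_sub]
    | 3, v =>
      convert comp_mem_onShellNull T r (LinearMap.inl K Ξ (Jets A ι m r))
        (hJ (v 0) (v 1) (v 2)) using 1
      refine LinearMap.ext fun s => ?_
      have := D_lambdaBar_ι_mul_ι_mul_ι δ C h.1 (v 0) (v 1) (v 2) s
      simp only [LinearMap.comp_apply, TensorProduct.mk_apply, ExteriorAlgebra.ιMulti_apply,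
        List.ofFn_succ, List.ofFn_zero, List.prod_cons, List.prod_nil, mul_one]
      rw [← mul_assoc]
      exact this
    | n + 4, v => exact h0 _ (D_lambdaBar_ιMulti_eq_zero δ C h.1 (by omega) v)

/-- `[δ(ξ), δ(η)] - δ̂(C(ξ, η))` as a bilinear map. -/
noncomputable def closureDefect (δ : Ξ →ₗ[K] SymmetricAlgebra K Φ →ₗ[K] Φ)
    (C : Ξ →ₗ[K] Ξ →ₗ[K] SymmetricAlgebra K Φ →ₗ[K] Ξ) :
    Ξ →ₗ[K] Ξ →ₗ[K] SymmetricAlgebra K Φ →ₗ[K] Φ :=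
  LinearMap.mk₂ K (fun ξ η => gerstenhaber (δ ξ) (δ η) - deltaHat δ (C ξ η))
    (fun ξ₁ ξ₂ η => by
      ext s
      simp [gerstenhaber, bar_add, deltaHat_add]
      abel)
    (fun c ξ η => by
      ext s
      simp [gerstenhaber, bar_smul, deltaHat_smul, smul_sub])
    (fun ξ η₁ η₂ => by
      ext s
      simp [gerstenhaber, bar_add, deltaHat_add]
      abel)
    (fun c ξ η => by
      ext s
      simp [gerstenhaber, bar_smul, deltaHat_smul, smul_sub])

theorem closureDefect_apply (δ : Ξ →ₗ[K] SymmetricAlgebra K Φ →ₗ[K] Φ)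
    (C : Ξ →ₗ[K] Ξ →ₗ[K] SymmetricAlgebra K Φ →ₗ[K] Ξ) (ξ η : Ξ) :
    closureDefect δ C ξ η = gerstenhaber (δ ξ) (δ η) - deltaHat δ (C ξ η) := rfl

/-- The commutator is antisymmetric by construction, and `deltaHat δ` is linear, so it inherits the
sign from `C`. -/
theorem closureDefect_skew (δ : Ξ →ₗ[K] SymmetricAlgebra K Φ →ₗ[K] Φ)
    {C : Ξ →ₗ[K] Ξ →ₗ[K] SymmetricAlgebra K Φ →ₗ[K] Ξ} (hC : ∀ ξ η, C ξ η = -C η ξ) (ξ η : Ξ) :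
    closureDefect δ C ξ η = -closureDefect δ C η ξ := by
  have h : deltaHat δ (-C η ξ) = -deltaHat δ (C η ξ) := by
    rw [← neg_one_smul K (C η ξ), deltaHat_smul, neg_one_smul]
  rw [closureDefect_apply, closureDefect_apply, hC ξ η, h, gerstenhaber, gerstenhaber]
  abel

end ShLie

end OnShell

open OnShell in
theorem mainTheorem4 {K A Φ₀ ι Ξ : Type*} [CommRing K] [Algebra ℚ K] [CommRing A] [Algebra K A]
    [AddCommGroup Φ₀] [Module A Φ₀] [Finite ι] [AddCommGroup Ξ] [Module K Ξ] {m : ℕ}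
    (T : FieldTheory A Φ₀ ι m) (r : ℕ∞)
    (δ : Ξ →ₗ[K] SymmetricAlgebra K (Jets A ι m r) →ₗ[K] Jets A ι m r)
    (C : Ξ →ₗ[K] Ξ →ₗ[K] SymmetricAlgebra K (Jets A ι m r) →ₗ[K] Ξ)
    (h : GeneralizedBBvD T r δ C) :
    (∃ ν : Ξ →ₗ[K] Ξ →ₗ[K] SymmetricAlgebra K (Jets A ι m r) →ₗ[K] Jets A ι m r,
      (∀ ξ η, ν ξ η = -ν η ξ) ∧
      (∀ ξ η, ν ξ η ∈ T.onShellNull K r (Jets A ι m r)) ∧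
      (∀ ξ η, gerstenhaber (δ ξ) (δ η) = deltaHat δ (C ξ η) + ν ξ η) ∧
      ∀ (ξ₁ ξ₂ : Ξ) (s : SymmetricAlgebra K (Jets A ι m r)),
        D δ C h.1 (lambdaBar (D δ C h.1)
            ((ExteriorAlgebra.ι K ξ₁ * ExteriorAlgebra.ι K ξ₂) ⊗ₜ s)) =
          (0, -gerstenhaber (δ ξ₁) (δ ξ₂) s + deltaHat δ (C ξ₁ ξ₂) s) ∧
        D δ C h.1 (lambdaBar (D δ C h.1)
            ((ExteriorAlgebra.ι K ξ₁ * ExteriorAlgebra.ι K ξ₂) ⊗ₜ s)) = (0, -ν ξ₁ ξ₂ s)) ∧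
    (∀ (ξ₁ ξ₂ ξ₃ : Ξ) (s : SymmetricAlgebra K (Jets A ι m r)),
      D δ C h.1 (lambdaBar (D δ C h.1)
          ((ExteriorAlgebra.ι K ξ₁ * ExteriorAlgebra.ι K ξ₂ * ExteriorAlgebra.ι K ξ₃) ⊗ₜ s)) =
        (jacobiator δ C ξ₁ ξ₂ ξ₃ s, 0)) ∧
    ((∀ ξ₁ ξ₂ ξ₃, jacobiator δ C ξ₁ ξ₂ ξ₃ ∈ T.onShellNull K r Ξ) →
      IsOnShellShLie T r (D δ C h.1)) := by
  -- The required equation forces `ν` to be the closure defect, whose membership in the null maps is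
  -- the hypothesis itself.
  refine ⟨⟨closureDefect δ C, closureDefect_skew δ h.1, h.2, fun ξ η => ?_, fun ξ₁ ξ₂ s =>
    ⟨D_lambdaBar_ι_mul_ι δ C h.1 ξ₁ ξ₂ s, ?_⟩⟩, D_lambdaBar_ι_mul_ι_mul_ι δ C h.1, fun hJ =>
    ⟨fun i hi ω hω s => ?_, fun i hi ω hω s => ?_, vanishesOnShell_of_jacobiator T r δ C h hJ⟩⟩
  · rw [closureDefect_apply, add_sub_cancel]
  · rw [D_lambdaBar_ι_mul_ι, closureDefect_apply, LinearMap.sub_apply, neg_sub, neg_add_eq_sub]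
  · by_cases h2 : i = 2
    · subst h2
      obtain ⟨f, hf⟩ := exists_D_eq_inl δ C h.1 hω
      rw [hf]
    · rw [D_eq_zero δ C h.1 hi h2 hω, Prod.snd_zero]
  · by_cases h1 : i = 1
    · subst h1
      obtain ⟨f, hf⟩ := exists_D_eq_inr δ C h.1 hω
      rw [hf]
    · rw [D_eq_zero δ C h.1 h1 hi hω, Prod.fst_zero]
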